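/- Let $(R,\mathfrak m)$ be a Cohen–Macaulay local ring of Krull dimension $d$. A finitely generated $R$-module is called maximal Cohen–Macaulay if it is zero or admits a regular sequence of length $d$ contained in $\mathfrak m$. For a finitely generated $R$-module $M$, let $\delta_R(M)$ be the smallest integer $n\ge 0$ for which there is a surjective $R$-linear map $X\oplus R^n\to M$ with $X$ a maximal Cohen–Macaulay $R$-module without nonzero free direct summand. Put $$\operatorname{index}(R)=\inf\{n\ge 1 \mid \delta_R(R/\mathfrak m^n)=1\},$$ and let the generalized Loewy length $\mathrm{g}\ell\ell(R)$ be the smallest integer $n\ge 1$ such that $\mathfrak m^n$ is contained in the ideal generated by some system of parameters of $R$. **Proposition 3.5.** Let $k$ be a finite field with $|k|$ elements and let $$R=k[[x,y]]\Big/\Big(y\prod_{\alpha\in k}(x+\alpha y)\Big).$$ Then $$\mathrm{g}\ell\ell(R)=\operatorname{index}(R)+1=|k|+2.$$ -/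

import Mathlib

universe u

section Invariants

variable (R : Type u) [CommRing R] [IsLocalRing R]

/-- A finitely generated module `X` over a local ring `R` is maximal Cohen-Macaulay if it is zero
or there is an `X`-regular sequence in the maximal ideal whose length is the Krull dimension of
`R`. The zero module counts as maximal Cohen-Macaulay. -/
def IsMaximalCohenMacaulay (X : Type u) [AddCommGroup X] [Module R X] : Prop :=
  Module.Finite R X ∧
    (Subsingleton X ∨
      ∃ rs : List R, (∀ r ∈ rs, r ∈ IsLocalRing.maximalIdeal R) ∧
        ((rs.length : ℕ) : WithBot ℕ∞) = ringKrullDim R ∧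
        RingTheory.Sequence.IsRegular X rs)

/-- `X` has no (nonzero) free direct summand. -/
def HasNoFreeSummand (X : Type u) [AddCommGroup X] [Module R X] : Prop :=
  ∀ P Q : Submodule R X, IsCompl P Q → Module.Free R P → P = ⊥

/-- Auslander's delta invariant of a finitely generated module `M`: the smallest `n` such that
there is a surjection `X ⊕ R ^ n → M` with `X` maximal Cohen-Macaulay without free direct
summand. -/
noncomputable def auslanderDelta (M : Type u) [AddCommGroup M] [Module R M] : ℕ :=
  sInf {n : ℕ | ∃ (X : Type u) (_ : AddCommGroup X) (_ : Module R X),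
    IsMaximalCohenMacaulay R X ∧ HasNoFreeSummand R X ∧
      ∃ φ : (X × (Fin n → R)) →ₗ[R] M, Function.Surjective φ}

/-- The index of `R`: the infimum of all `n ≥ 1` with `δ (R / 𝔪 ^ n) = 1` (it is `⊤` if there is
no such `n`). -/
noncomputable def localIndex : ℕ∞ :=
  sInf {N : ℕ∞ | ∃ n : ℕ, N = n ∧ 1 ≤ n ∧
    auslanderDelta R (R ⧸ IsLocalRing.maximalIdeal R ^ n) = 1}

/-- A system of parameters of a (Noetherian) local ring: a family of `d = dim R` elements of the
maximal ideal that generates an ideal primary to the maximal ideal. -/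
def IsSystemOfParameters {d : ℕ} (x : Fin d → R) : Prop :=
  (d : WithBot ℕ∞) = ringKrullDim R ∧
    (∀ i, x i ∈ IsLocalRing.maximalIdeal R) ∧
    (Ideal.span (Set.range x)).radical = IsLocalRing.maximalIdeal R

/-- The generalized Loewy length of `R`: the smallest `n ≥ 1` such that `𝔪 ^ n` is contained in
the ideal generated by a system of parameters (`⊤` if there is no such `n`). -/
noncomputable def generalizedLoewyLength : ℕ∞ :=
  sInf {N : ℕ∞ | ∃ n : ℕ, N = n ∧ 1 ≤ n ∧
    ∃ (d : ℕ) (x : Fin d → R), IsSystemOfParameters R x ∧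
      IsLocalRing.maximalIdeal R ^ n ≤ Ideal.span (Set.range x)}

end Invariants

section Ring

variable (k : Type u) [Field k] [Fintype k]

/-- The power series `y ∏_{α ∈ k} (x + α y)` in `k⟦x, y⟧`, with `x = X 0` and `y = X 1`. -/
noncomputable def allLines : MvPowerSeries (Fin 2) k :=
  MvPowerSeries.X 1 *
    ∏ α : k, (MvPowerSeries.X 0 + MvPowerSeries.C α * MvPowerSeries.X 1)

/-- The hypersurface ring `k⟦x, y⟧ / (y ∏_{α ∈ k} (x + α y))`. -/
abbrev AllLinesRing : Type u :=
  MvPowerSeries (Fin 2) k ⧸ Ideal.span {allLines k}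

instance allLinesRing_nontrivial : Nontrivial (AllLinesRing k) := by
  refine Ideal.Quotient.nontrivial_iff.mpr fun h => ?_
  have h1 : IsUnit (allLines k) := Ideal.span_singleton_eq_top.mp h
  have h2 := h1.map (MvPowerSeries.constantCoeff (σ := Fin 2) (R := k))
  simp [allLines] at h2

instance allLinesRing_isLocalRing : IsLocalRing (AllLinesRing k) :=
  IsLocalRing.of_surjective' (Ideal.Quotient.mk _) Ideal.Quotient.mk_surjective

end Ring

/-!
Write `S = k⟦x, y⟧` with maximal ideal `𝔫`, `q = |k|`, `f` for the product of all lines and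
`R = S ⧸ (f)`, with maximal ideal `𝔪`. The order of `f` is `q + 1`.

*Index.* Let `g = f / x`, a form of degree `q`. For `n ≤ q` the cyclic module `R ⧸ (g)` maps onto
`R ⧸ 𝔪 ^ n`; it is maximal Cohen-Macaulay because `x` is regular on it, and has no free summand
because `g` annihilates it. Hence `δ (R ⧸ 𝔪 ^ n) = 0`
(`auslanderDelta_allLinesRing_of_le`). If a maximal Cohen-Macaulay module `X` without free summand
mapped onto `R ⧸ 𝔪 ^ (q + 1)`, the kernel `K` of a presentation `Sⁿ → X` would be free
(`free_ker_of_isSMulRegular`), and the coordinates in `K` of the elements of `f Sⁿ` would lie in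
`𝔫`, as `X` has no free summand. Lifting `Sⁿ → R ⧸ 𝔪 ^ (q + 1)` to a functional on `Sⁿ` and
evaluating it on `f Sⁿ` gives `f ∈ 𝔫 * 𝔫 ^ (q + 1)`
(`mem_maximalIdeal_mul_comap_of_surjective`), which contradicts the order of `f`. So the index is
`q + 1`.

*Generalized Loewy length.* Restricted to the curve `x = -y ^ 2`, the series `f` is a unit times
`y ^ (q + 2)`, so `𝔪 ^ (q + 2)` lies in the ideal of the parameter `x + y ^ 2`
(`map_eq_zero_of_mem_pow`). Conversely suppose `𝔫 ^ (q + 1) ⊆ (t, f)` with `t ∈ 𝔫` of order `s`.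
Comparing components of degree `q + 1` in the chart `x = T z`, `y = z`, where `f` becomes
`z ^ (q + 1)` times `∏ (T + α)`, every `T ^ i` with `i ≤ q + 1` is a combination `A τ + c ∏ (T + α)`
with `deg A ≤ q + 1 - s`, `c ∈ k`, and `τ` the dehomogenized initial form of `t`
(`exists_forall_X_pow_eq`). This is impossible (`false_of_forall_X_pow_eq`): if `s = 1`, then `τ`
has a root in `k`, which is also a root of `∏ (T + α)` as every line over `k` is a factor of `f`; if
`s ≥ 2`, then `1` and `T` are independent modulo `τ`.
-/

/-! ### Modules of positive depth over a two-dimensional regular local ring -/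

open Pointwise in
/-- Over a local domain whose maximal ideal is generated by `x` and `y`, with `x` prime and not
dividing `y`, the first syzygy of a module of positive depth is free. Since `r` kills no nonzero
element of `X`, neither do `x` and `y` together; this makes `y`, hence every nonzero element of the
discrete valuation ring `S ⧸ (x)`, regular on `ker p / x ker p`. -/
theorem free_ker_of_isSMulRegular {S X : Type*} [CommRing S] [IsDomain S] [IsLocalRing S]
    [IsNoetherianRing S] [AddCommGroup X] [Module S X] {x y r : S} (hx : Prime x) (hxy : ¬ x ∣ y)
    (hm : IsLocalRing.maximalIdeal S = Ideal.span {x, y})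
    (hr : r ∈ IsLocalRing.maximalIdeal S) (hreg : IsSMulRegular X r)
    {n : ℕ} (p : (Fin n → S) →ₗ[S] X) : Module.Free S (LinearMap.ker p) := by
  have hxm : x ∈ IsLocalRing.maximalIdeal S := hm ▸ Ideal.subset_span (by simp)
  have hxK : IsSMulRegular (LinearMap.ker p) x := by
    intro u v huv
    have : x • (u : Fin n → S) = x • (v : Fin n → S) := congrArg Subtype.val huv
    exact Subtype.ext (smul_right_injective _ hx.ne_zero this)
  have hjac : x ∈ (⊥ : Ideal S).jacobson := by
    rwa [IsLocalRing.jacobson_eq_maximalIdeal _ bot_ne_top]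
  have : Module.FinitePresentation S (LinearMap.ker p) := Module.finitePresentation_of_finite _ _
  rw [← Module.free_quotSMulTop_iff_free S _ hjac hxK]
  let D := S ⧸ Ideal.span {x}
  have : (Ideal.span {x}).IsPrime := (Ideal.span_singleton_prime hx.ne_zero).mpr hx
  have : IsLocalRing D :=
    IsLocalRing.of_surjective' (Ideal.Quotient.mk (Ideal.span {x})) Ideal.Quotient.mk_surjective
  let ybar : D := Ideal.Quotient.mk _ y
  have hmD : IsLocalRing.maximalIdeal D = Ideal.span {ybar} := by
    rw [← IsLocalRing.map_maximalIdeal_of_surjective _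
      (Ideal.Quotient.mk_surjective (I := Ideal.span {x})), hm, Ideal.map_span, Set.image_pair,
      Ideal.Quotient.mk_singleton_self, Ideal.span_insert_zero]
  have hprinc : (IsLocalRing.maximalIdeal D).IsPrincipal := ⟨ybar, hmD⟩
  have tfae := tfae_of_isNoetherianRing_of_isLocalRing_of_isDomain D
  have hpow := (tfae.out 4 6).mp hprinc
  have : IsPrincipalIdealRing D := (tfae.out 4 0).mp hprinc
  have hy : IsSMulRegular (QuotSMulTop x (LinearMap.ker p)) ybar := by
    rw [isSMulRegular_iff_right_eq_zero_of_smul]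
    intro u hu
    obtain ⟨v, rfl⟩ := Submodule.Quotient.mk_surjective _ u
    have hu' : Submodule.Quotient.mk (p := x • (⊤ : Submodule S (LinearMap.ker p))) (y • v) = 0 :=
      hu
    rw [Submodule.Quotient.mk_eq_zero] at hu' ⊢
    obtain ⟨v', -, hv'⟩ := (Submodule.mem_smul_pointwise_iff_exists _ _ _).mp hu'
    have heq (i) : y * (v : Fin n → S) i = x * (v' : Fin n → S) i :=
      congrFun (congrArg Subtype.val hv'.symm) i
    have hdvd (i) : ∃ w, (v : Fin n → S) i = x * w :=
      (hx.dvd_or_dvd ⟨_, heq i⟩).resolve_left hxy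
    choose w hw using hdvd
    have hvw : (v : Fin n → S) = x • w := funext hw
    have hv'w : (v' : Fin n → S) = y • w := by
      funext i
      refine mul_left_cancel₀ hx.ne_zero ?_
      rw [← heq i, hw, Pi.smul_apply, smul_eq_mul]
      ring
    have hxw : x • p w = 0 := by rw [← map_smul, ← hvw]; exact v.2
    have hyw : y • p w = 0 := by rw [← map_smul, ← hv'w]; exact v'.2
    have hrw : r • p w = 0 := by
      rw [hm, Ideal.mem_span_pair] at hr
      obtain ⟨c, d, rfl⟩ := hr
      rw [add_smul, mul_smul, mul_smul, hxw, hyw, smul_zero, smul_zero, add_zero]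
    have hpw : p w = 0 := hreg.right_eq_zero_of_smul hrw
    exact (Submodule.mem_smul_pointwise_iff_exists _ _ _).mpr
      ⟨⟨w, hpw⟩, Submodule.mem_top, Subtype.ext hvw.symm⟩
  have : Module.IsTorsionFree D (QuotSMulTop x (LinearMap.ker p)) := by
    refine ⟨fun a ha => ?_⟩
    obtain ⟨N, hN⟩ := hpow (Ideal.span {a}) (by simpa using ha.ne_zero)
    rw [hmD, Ideal.span_singleton_pow] at hN
    obtain ⟨c, hc⟩ : a ∣ ybar ^ N :=
      Ideal.mem_span_singleton.mp (hN ▸ Ideal.mem_span_singleton_self _)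
    have := hy.pow N
    rw [hc, mul_comm] at this
    exact this.of_mul
  have : Module.Finite D (QuotSMulTop x (LinearMap.ker p)) :=
    Module.Finite.of_restrictScalars_finite S D _
  exact Module.free_of_finite_type_torsion_free'

theorem HasNoFreeSummand.not_surjective {R X : Type u} [CommRing R] [IsLocalRing R]
    [AddCommGroup X] [Module R X] (h : HasNoFreeSummand R X) (l : X →ₗ[R] R) :
    ¬ Function.Surjective l := by
  intro hl
  obtain ⟨s, hs⟩ := Module.projective_lifting_property l LinearMap.id hl
  have hs' : ∀ a, l (s a) = a := fun a => LinearMap.congr_fun hs a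
  have hinj : Function.Injective s := Function.LeftInverse.injective hs'
  have hfree : Module.Free R (LinearMap.range s) :=
    Module.Free.of_equiv (LinearEquiv.ofInjective s hinj)
  have hcompl : IsCompl (LinearMap.range s) (LinearMap.ker (s.rangeRestrict ∘ₗ l)) := by
    refine LinearMap.isCompl_of_proj ?_
    rintro ⟨_, a, rfl⟩
    exact Subtype.ext (congrArg s (hs' a))
  have h1 : s 1 ∈ LinearMap.range s := ⟨1, rfl⟩
  rw [h _ _ hcompl hfree, Submodule.mem_bot] at h1
  exact one_ne_zero ((hs' 1).symm.trans (by rw [h1, map_zero]))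

/-- If `R = S ⧸ (f)` with `S` a two-dimensional regular local ring and `R ⧸ J` is nonzero and an
image of a finite `R`-module `X` of positive depth without free summand, then `f ∈ 𝔫 J'`, where
`𝔫` is the maximal ideal of `S` and `J'` the preimage of `J`. The kernel `K` of a presentation
`Sⁿ → X` is free and contains `f Sⁿ`; a coordinate of some `f v` that is a unit would split a copy
of `R` off `X`. Hence these coordinates lie in `𝔫`, whereas a lift `a : Sⁿ → S` of
`Sⁿ → X → R ⧸ J` sends `K` into `J'` and some `v` to a unit. -/
theorem mem_maximalIdeal_mul_comap_of_surjective {S : Type u} [CommRing S] [IsDomain S]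
    [IsLocalRing S] [IsNoetherianRing S] {x y f : S} (hx : Prime x) (hxy : ¬ x ∣ y)
    (hm : IsLocalRing.maximalIdeal S = Ideal.span {x, y})
    [IsLocalRing (S ⧸ Ideal.span {f})]
    {X : Type u} [AddCommGroup X] [Module (S ⧸ Ideal.span {f}) X]
    [Module.Finite (S ⧸ Ideal.span {f}) X] (hX : HasNoFreeSummand (S ⧸ Ideal.span {f}) X)
    {r : S ⧸ Ideal.span {f}} (hr : r ∈ IsLocalRing.maximalIdeal (S ⧸ Ideal.span {f}))
    (hreg : IsSMulRegular X r) {J : Ideal (S ⧸ Ideal.span {f})} (hJ : J ≠ ⊤)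
    (φ : X →ₗ[S ⧸ Ideal.span {f}] ((S ⧸ Ideal.span {f}) ⧸ J)) (hφ : Function.Surjective φ) :
    f ∈ IsLocalRing.maximalIdeal S * J.comap (Ideal.Quotient.mk (Ideal.span {f})) := by
  let R := S ⧸ Ideal.span {f}
  let π : S →+* R := Ideal.Quotient.mk (Ideal.span {f})
  have hπ : Function.Surjective π := Ideal.Quotient.mk_surjective
  let : Module S X := Module.compHom X π
  have : IsScalarTower S R X := ⟨fun a b c => by
    change (a • b) • c = π a • b • c
    rw [smul_smul, Algebra.smul_def]; rfl⟩
  have : Module.Finite S X := Module.Finite.trans R X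
  obtain ⟨n, p, hp⟩ := Module.Finite.exists_fin' S X
  obtain ⟨r', rfl⟩ := hπ r
  have hr' : r' ∈ IsLocalRing.maximalIdeal S := by
    rw [IsLocalRing.mem_maximalIdeal, mem_nonunits_iff] at hr ⊢
    exact fun h => hr (h.map π)
  have hreg' : IsSMulRegular X r' := hreg
  have hfree : Module.Free S (LinearMap.ker p) :=
    free_ker_of_isSMulRegular hx hxy hm hr' hreg' p
  let b := Module.Free.chooseBasis S (LinearMap.ker p)
  have hfX : ∀ u : X, f • u = 0 := fun u => by
    change π f • u = 0
    rw [show π f = 0 from Ideal.Quotient.mk_singleton_self f, zero_smul]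
  -- `q` is the multiplication by `f`, as a map from `Sⁿ` to the kernel.
  let q : (Fin n → S) →ₗ[S] LinearMap.ker p :=
    (LinearMap.lsmul S (Fin n → S) f).codRestrict _ fun v => by simp [hfX]
  have hunit : ∀ v j, b.repr (q v) j ∈ IsLocalRing.maximalIdeal S := by
    intro v j
    by_contra hu
    rw [IsLocalRing.mem_maximalIdeal, mem_nonunits_iff, not_not] at hu
    let l : (Fin n → S) →ₗ[S] R := (Submodule.mkQ (Ideal.span {f})) ∘ₗ b.coord j ∘ₗ q
    have hl : LinearMap.ker p ≤ LinearMap.ker l := by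
      intro w hw
      have : q w = f • (⟨w, hw⟩ : LinearMap.ker p) := rfl
      rw [LinearMap.mem_ker, LinearMap.comp_apply, LinearMap.comp_apply, this, map_smul]
      refine (Submodule.Quotient.mk_eq_zero _).mpr ?_
      exact Ideal.mul_mem_right _ _ (Ideal.mem_span_singleton_self f)
    let lX : X →ₗ[S] R :=
      (LinearMap.ker p).liftQ l hl ∘ₗ (p.quotKerEquivOfSurjective hp).symm.toLinearMap
    have hlX : lX (p v) = π (b.repr (q v) j) := by
      have : (p.quotKerEquivOfSurjective hp).symm (p v) = Submodule.Quotient.mk v :=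
        (LinearEquiv.symm_apply_eq _).mpr rfl
      simp only [lX, LinearMap.comp_apply, LinearEquiv.coe_coe, this]
      rfl
    let lR : X →ₗ[R] R := lX.extendScalarsOfSurjective hπ
    refine hX.not_surjective lR fun c => ?_
    obtain ⟨d, hd⟩ := (hu.map π).exists_left_inv
    refine ⟨(c * d) • p v, ?_⟩
    rw [map_smul, smul_eq_mul, show lR (p v) = π (b.repr (q v) j) from hlX, mul_assoc, hd, mul_one]
  let qJ : S →ₗ[S] R ⧸ J := (J.mkQ.restrictScalars S) ∘ₗ Submodule.mkQ (Ideal.span {f})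
  have hqJ : Function.Surjective qJ :=
    (Submodule.mkQ_surjective J).comp (Submodule.mkQ_surjective _)
  obtain ⟨a, ha⟩ := Module.projective_lifting_property qJ (φ.restrictScalars S ∘ₗ p) hqJ
  have ha' : ∀ v, qJ (a v) = φ (p v) := fun v => LinearMap.congr_fun ha v
  have hker : ∀ s, qJ s = 0 ↔ s ∈ J.comap π := fun s => Submodule.Quotient.mk_eq_zero J
  obtain ⟨u, hu⟩ := hφ 1
  obtain ⟨v, rfl⟩ := hp u
  have hav : IsUnit (a v) := by
    by_contra hn
    -- Otherwise `1 ∈ R ⧸ J` is the class of an element of the maximal ideal.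
    have hmem : π (a v) - 1 ∈ J := by
      rw [← Ideal.Quotient.mk_eq_mk_iff_sub_mem, map_one, ← hu]
      exact ha' v
    have hna : π (a v) ∈ IsLocalRing.maximalIdeal R := by
      rw [← IsLocalRing.map_maximalIdeal_of_surjective π hπ]
      exact Ideal.mem_map_of_mem π hn
    have h1 : (1 : R) ∈ IsLocalRing.maximalIdeal R := by
      have := sub_mem hna (IsLocalRing.le_maximalIdeal hJ hmem)
      rwa [sub_sub_cancel] at this
    exact h1 isUnit_one
  have hmem : a v * f ∈ IsLocalRing.maximalIdeal S * J.comap π := by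
    have h1 : a v * f = a (q v) := by
      rw [show (q v : Fin n → S) = f • v from rfl, map_smul, smul_eq_mul, mul_comm]
    have h2 : (q v : Fin n → S) = ∑ j, b.repr (q v) j • (b j : Fin n → S) := by
      conv_lhs => rw [← b.sum_repr (q v)]
      rw [Submodule.coe_sum]
      rfl
    rw [h1, h2, map_sum]
    refine Ideal.sum_mem _ fun j _ => ?_
    rw [map_smul, smul_eq_mul]
    refine Ideal.mul_mem_mul (hunit v j) ((hker _).mp ?_)
    rw [ha', show p (b j : Fin n → S) = 0 from (b j).2, map_zero]
  exact (Ideal.unit_mul_mem_iff_mem _ hav).mp hmem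

/-! ### Power series in two variables and the blow-up chart -/

namespace MvPowerSeries

variable {k : Type*} [Field k]

instance : IsDomain (MvPowerSeries (Fin 2) k) := NoZeroDivisors.to_isDomain _

theorem prime_X_zero : Prime (X 0 : MvPowerSeries (Fin 2) k) := by
  rw [← MulEquiv.prime_iff (finSuccEquiv k 1), finSuccEquiv_X_zero]
  have : IsDomain (MvPowerSeries (Fin 1) k) := NoZeroDivisors.to_isDomain _
  exact PowerSeries.X_prime

theorem not_X_zero_dvd_C_mul_X_one {α : k} (hα : α ≠ 0) :
    ¬ (X 0 : MvPowerSeries (Fin 2) k) ∣ C α * X 1 := by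
  intro h
  have := X_dvd_iff.mp h (Finsupp.single 1 1) (by simp)
  simp [hα] at this

theorem not_X_zero_dvd_X_one : ¬ (X 0 : MvPowerSeries (Fin 2) k) ∣ X 1 := by
  simpa using not_X_zero_dvd_C_mul_X_one (one_ne_zero (α := k))

theorem mem_maximalIdeal_iff {p : MvPowerSeries (Fin 2) k} :
    p ∈ IsLocalRing.maximalIdeal (MvPowerSeries (Fin 2) k) ↔ constantCoeff p = 0 := by
  rw [IsLocalRing.mem_maximalIdeal, mem_nonunits_iff, isUnit_iff_constantCoeff, isUnit_iff_ne_zero,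
    not_not]

theorem maximalIdeal_eq_span :
    IsLocalRing.maximalIdeal (MvPowerSeries (Fin 2) k) = Ideal.span {X 0, X 1} := by
  apply le_antisymm
  · intro p hp
    rw [mem_maximalIdeal_iff] at hp
    -- Split off the monomials that do not involve `X 0`.
    let q : MvPowerSeries (Fin 2) k := fun d => if d 0 = 0 then coeff d p else 0
    have hq (d) : coeff d q = if d 0 = 0 then coeff d p else 0 := rfl
    obtain ⟨a, ha⟩ : X 1 ∣ q := X_dvd_iff.mpr fun d hd => by
      rw [hq]
      split_ifs with h
      · have : d = 0 := by ext i; fin_cases i <;> simpa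
        rw [this, coeff_zero_eq_constantCoeff_apply, hp]
      · rfl
    obtain ⟨b, hb⟩ : X 0 ∣ p - q := X_dvd_iff.mpr fun d hd => by
      rw [map_sub, hq, if_pos hd, sub_self]
    rw [Ideal.mem_span_pair]
    exact ⟨b, a, by rw [mul_comm b, mul_comm a, ← ha, ← hb, sub_add_cancel]⟩
  · rw [Ideal.span_le]
    rintro _ (rfl | rfl) <;> exact mem_maximalIdeal_iff.mpr (constantCoeff_X _)

theorem linear_mem_maximalIdeal (α : k) :
    (X 0 + C α * X 1 : MvPowerSeries (Fin 2) k) ∈ IsLocalRing.maximalIdeal _ := by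
  rw [mem_maximalIdeal_iff]; simp

theorem X_one_mem_maximalIdeal :
    (X 1 : MvPowerSeries (Fin 2) k) ∈ IsLocalRing.maximalIdeal _ :=
  mem_maximalIdeal_iff.mpr (constantCoeff_X _)

theorem X_one_mul_prod_mem_pow (s : Finset k) :
    X 1 * ∏ α ∈ s, (X 0 + C α * X 1) ∈
      IsLocalRing.maximalIdeal (MvPowerSeries (Fin 2) k) ^ (s.card + 1) := by
  rw [pow_succ']
  refine Ideal.mul_mem_mul X_one_mem_maximalIdeal ?_
  rw [← Finset.prod_const]
  exact Ideal.prod_mem_prod fun α _ => linear_mem_maximalIdeal α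

open Polynomial in
theorem hasSubst_blowup :
    HasSubst ![PowerSeries.C (Polynomial.X : k[X]) * PowerSeries.X, PowerSeries.X] := by
  refine hasSubst_of_constantCoeff_zero fun i => ?_
  fin_cases i
  · change PowerSeries.constantCoeff (PowerSeries.C Polynomial.X * PowerSeries.X) = 0
    simp
  · exact PowerSeries.constantCoeff_X

open Polynomial in
/-- The chart `k⟦x, y⟧ → k[T]⟦z⟧`, `x ↦ T z`, `y ↦ z` of the blow-up of the closed point. The
coefficient of `z ^ n` in the image of `p` is the degree `n` component of `p`, dehomogenized. -/
noncomputable def blowup : MvPowerSeries (Fin 2) k →ₐ[k] PowerSeries k[X] :=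
  substAlgHom (hasSubst_blowup (k := k))

theorem blowup_X_zero :
    blowup (X 0 : MvPowerSeries (Fin 2) k) = PowerSeries.C Polynomial.X * PowerSeries.X := by
  rw [blowup, substAlgHom_X]; rfl

theorem blowup_X_one : blowup (X 1 : MvPowerSeries (Fin 2) k) = PowerSeries.X := by
  rw [blowup, substAlgHom_X]; rfl

theorem blowup_C (a : k) :
    blowup (C a : MvPowerSeries (Fin 2) k) = PowerSeries.C (Polynomial.C a) := by
  have := (blowup (k := k)).commutes a
  rwa [algebraMap_apply, PowerSeries.algebraMap_apply] at this

theorem natDegree_coeff_blowup_le (p : MvPowerSeries (Fin 2) k) (n : ℕ) :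
    (PowerSeries.coeff n (blowup p)).natDegree ≤ n := by
  rw [Polynomial.natDegree_le_iff_degree_le, ← Polynomial.mem_degreeLE]
  rw [PowerSeries.coeff, blowup, substAlgHom_apply, coeff_subst hasSubst_blowup]
  refine finsum_induction (· ∈ Polynomial.degreeLE k n) (zero_mem _) (fun _ _ => add_mem)
    fun d => ?_
  refine Submodule.smul_mem _ _ ?_
  have : (d.prod fun s e =>
      ![PowerSeries.C (Polynomial.X : Polynomial k) * PowerSeries.X, PowerSeries.X] s ^ e) =
      PowerSeries.C (Polynomial.X ^ d 0) * PowerSeries.X ^ (d 0 + d 1) := by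
    rw [Finsupp.prod_fintype _ _ (by simp), Fin.prod_univ_two]
    simp
    ring
  rw [this]
  change PowerSeries.coeff n _ ∈ _
  rw [PowerSeries.coeff_C_mul, PowerSeries.coeff_X_pow]
  split_ifs with h
  · rw [mul_one, Polynomial.mem_degreeLE]
    refine (Polynomial.degree_X_pow_le _).trans ?_
    exact_mod_cast (by omega)
  · simp

theorem X_pow_dvd_blowup {p : MvPowerSeries (Fin 2) k} {n : ℕ}
    (hp : p ∈ IsLocalRing.maximalIdeal (MvPowerSeries (Fin 2) k) ^ n) :
    PowerSeries.X ^ n ∣ blowup p := by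
  rw [← Ideal.mem_span_singleton, ← Ideal.span_singleton_pow, ← Ideal.mem_comap]
  refine (Ideal.pow_right_mono ?_ n).trans (Ideal.le_comap_pow _ n) hp
  rw [maximalIdeal_eq_span, Ideal.span_le]
  rintro _ (rfl | rfl)
  · rw [SetLike.mem_coe, Ideal.mem_comap, blowup_X_zero]
    exact Ideal.mul_mem_left _ _ (Ideal.mem_span_singleton_self _)
  · rw [SetLike.mem_coe, Ideal.mem_comap, blowup_X_one]
    exact Ideal.mem_span_singleton_self _

theorem coeff_zero_blowup (p : MvPowerSeries (Fin 2) k) :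
    PowerSeries.coeff 0 (blowup p) = Polynomial.C (constantCoeff p) := by
  have h : p - C (constantCoeff p) ∈ IsLocalRing.maximalIdeal (MvPowerSeries (Fin 2) k) := by
    rw [mem_maximalIdeal_iff]; simp
  rw [← pow_one (IsLocalRing.maximalIdeal _)] at h
  have := PowerSeries.X_pow_dvd_iff.mp (X_pow_dvd_blowup h) 0 one_pos
  rw [map_sub, map_sub, blowup_C, sub_eq_zero] at this
  rw [this]
  simp

end MvPowerSeries

section AllLines

open MvPowerSeries

variable {k : Type u} [Field k] [Fintype k]

theorem blowup_allLines :
    blowup (allLines k) = PowerSeries.C (∏ α : k, (Polynomial.X + Polynomial.C α)) *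
      PowerSeries.X ^ (Fintype.card k + 1) := by
  have (α : k) : blowup (X 0 + C α * X 1) =
      PowerSeries.C (Polynomial.X + Polynomial.C α) * PowerSeries.X := by
    rw [map_add, map_mul, blowup_X_zero, blowup_X_one, blowup_C, map_add, add_mul]
  rw [allLines, map_mul, map_prod, blowup_X_one, Finset.prod_congr rfl fun α _ => this α,
    Finset.prod_mul_distrib, Finset.prod_const, Finset.card_univ, map_prod]
  ring

end AllLines

/-! ### Dehomogenized initial forms -/

section Polynomial

open Polynomial

variable {k : Type*} [Field k]

theorem monic_prod_X_add_C [Fintype k] : (∏ α : k, (X + C α : k[X])).Monic :=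
  monic_prod_of_monic _ _ fun α _ => monic_X_add_C α

theorem natDegree_prod_X_add_C [Fintype k] :
    (∏ α : k, (X + C α : k[X])).natDegree = Fintype.card k := by
  rw [natDegree_prod_of_monic _ _ fun α _ => monic_X_add_C α]
  simp

theorem eval_prod_X_add_C [Fintype k] (β : k) : (∏ α : k, (X + C α : k[X])).eval β = 0 := by
  rw [eval_prod]
  exact Finset.prod_eq_zero (Finset.mem_univ (-β)) (by simp)

/-- The contradiction behind the lower bound for the generalized Loewy length, on the level of
dehomogenized initial forms: `τ` is the initial form, of degree `s`, of a hypothetical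
parameter. -/
theorem false_of_forall_X_pow_eq {F τ : k[X]} {q s : ℕ} (hFdeg : F.natDegree ≤ q)
    (hF : ∀ β, F.eval β = 0) (hs : s ≠ 0) (hsq : s ≤ q + 1) (hτ : τ.natDegree ≤ s)
    (h : ∀ i ≤ q + 1, ∃ (A : k[X]) (c : k), A.natDegree ≤ q + 1 - s ∧
      (X ^ i : k[X]) = A * τ + C c * F) : False := by
  have hdeg : τ.natDegree = s := by
    obtain ⟨A, c, hA, hi⟩ := h (q + 1) le_rfl
    by_contra hne
    have h1 : (A * τ + C c * F).natDegree ≤ q := by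
      refine (natDegree_add_le _ _).trans (max_le ?_ ((natDegree_C_mul_le _ _).trans hFdeg))
      refine natDegree_mul_le.trans ?_
      omega
    rw [← hi, natDegree_X_pow] at h1
    omega
  obtain ⟨A, c, -, h0⟩ := h 0 (by omega)
  obtain ⟨B, d, -, h1⟩ := h 1 (by omega)
  rw [pow_zero] at h0
  rw [pow_one] at h1
  obtain rfl | hs2 : s = 1 ∨ 2 ≤ s := by omega
  -- A linear initial form vanishes at a point of `k`, where `F` vanishes as well.
  · obtain ⟨β, hβ⟩ := exists_root_of_degree_eq_one
      ((degree_eq_iff_natDegree_eq_of_pos one_pos).mpr hdeg)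
    have := congrArg (eval β) h0
    simp [hF, hβ.eq_zero] at this
  -- Otherwise `1` and `X` are independent modulo `τ`, yet both are multiples of `F`.
  · have hc : c ≠ 0 := by
      rintro rfl
      have hu : IsUnit τ := IsUnit.of_mul_eq_one_right A (by rw [h0]; simp)
      have := natDegree_eq_zero_of_isUnit hu
      omega
    have hdvd : τ ∣ C c * X - C d := by
      refine ⟨C c * B - C d * A, ?_⟩
      linear_combination C c * h1 - C d * h0
    have hne : C c * X - C d ≠ 0 := by
      intro h
      have := congrArg (fun p => coeff p 1) h
      simp [hc, coeff_C] at this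
    have := natDegree_le_of_dvd hdvd hne
    have h2 : (C c * X - C d).natDegree ≤ 1 := by compute_degree
    omega

end Polynomial

section AllLines

open MvPowerSeries

variable {k : Type u} [Field k] [Fintype k]

/-! ### The order of the product of all lines -/

theorem allLines_mem_pow :
    allLines k ∈ IsLocalRing.maximalIdeal (MvPowerSeries (Fin 2) k) ^ (Fintype.card k + 1) :=
  X_one_mul_prod_mem_pow Finset.univ

theorem allLines_notMem_pow :
    allLines k ∉ IsLocalRing.maximalIdeal (MvPowerSeries (Fin 2) k) ^ (Fintype.card k + 2) := by
  intro h
  have := PowerSeries.X_pow_dvd_iff.mp (X_pow_dvd_blowup h) (Fintype.card k + 1) (by omega)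
  rw [blowup_allLines, PowerSeries.coeff_C_mul, PowerSeries.coeff_X_pow_self, mul_one] at this
  exact monic_prod_X_add_C.ne_zero this

/-! ### Identities `p = a t + b f` in the blow-up chart -/

/-- If every `x ^ i y ^ (q + 1 - i)` has the form `a t + b f`, with `q = |k|` and `f` the product of
all lines, then dividing by powers of `z` in the blow-up chart gives identities between
polynomials. Here `s` is the order of `t` and `τ` its dehomogenized initial form. -/
theorem exists_forall_X_pow_eq {t : MvPowerSeries (Fin 2) k}
    (ht : t ∈ IsLocalRing.maximalIdeal (MvPowerSeries (Fin 2) k))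
    (h : ∀ p ∈ IsLocalRing.maximalIdeal (MvPowerSeries (Fin 2) k) ^ (Fintype.card k + 1),
      ∃ a b, p = a * t + b * allLines k) :
    ∃ (s : ℕ) (τ : Polynomial k), s ≠ 0 ∧ s ≤ Fintype.card k + 1 ∧ τ.natDegree ≤ s ∧
      ∀ i ≤ Fintype.card k + 1, ∃ (A : Polynomial k) (c : k),
        A.natDegree ≤ Fintype.card k + 1 - s ∧
        (Polynomial.X ^ i : Polynomial k) =
          A * τ + Polynomial.C c * ∏ α : k, (Polynomial.X + Polynomial.C α) := by
  set F : Polynomial k := ∏ α : k, (Polynomial.X + Polynomial.C α)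
  set e := Fintype.card k + 1
  have key : ∀ i ≤ e, ∃ a b : MvPowerSeries (Fin 2) k,
      PowerSeries.C (Polynomial.X ^ i) * PowerSeries.X ^ e =
        blowup a * blowup t + blowup b * (PowerSeries.C F * PowerSeries.X ^ e) := by
    intro i hi
    obtain ⟨a, b, hab⟩ := h (X 0 ^ i * X 1 ^ (e - i)) (by
      rw [← Nat.add_sub_cancel' hi, pow_add, Nat.add_sub_cancel_left]
      exact Ideal.mul_mem_mul
        (Ideal.pow_mem_pow (mem_maximalIdeal_iff.mpr (constantCoeff_X _)) _)
        (Ideal.pow_mem_pow X_one_mem_maximalIdeal _))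
    refine ⟨a, b, ?_⟩
    rw [← blowup_allLines, ← map_mul, ← map_mul, ← map_add, ← hab, map_mul, map_pow blowup,
      map_pow blowup, blowup_X_zero, blowup_X_one, mul_pow, mul_assoc, ← pow_add,
      Nat.add_sub_cancel' hi, map_pow]
  -- If the order of `t` exceeded `e`, then `1` would be a multiple of `F`, which has roots.
  have hex : ∃ s, PowerSeries.coeff s (blowup t) ≠ 0 ∧ s ≤ e := by
    by_contra! hno
    obtain ⟨u, hu⟩ : PowerSeries.X ^ (e + 1) ∣ blowup t :=
      PowerSeries.X_pow_dvd_iff.mpr fun m hm => by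
        by_contra hne
        have := hno m hne
        omega
    obtain ⟨a, b, hab⟩ := key 0 (Nat.zero_le _)
    have h1 : 1 = blowup a * u * PowerSeries.X + blowup b * PowerSeries.C F := by
      refine mul_right_cancel₀ (pow_ne_zero e PowerSeries.X_ne_zero) ?_
      rw [pow_zero, map_one, hu] at hab
      rw [hab]
      ring
    have h2 := congrArg (PowerSeries.constantCoeff) h1
    rw [map_add, map_mul, map_mul, map_mul, PowerSeries.constantCoeff_X, mul_zero, zero_add,
      map_one, PowerSeries.constantCoeff_C] at h2
    have h3 := congrArg (Polynomial.eval 0) h2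
    rw [Polynomial.eval_mul, eval_prod_X_add_C] at h3
    simp at h3
  classical
  let s := Nat.find hex
  obtain ⟨hs, hse⟩ : PowerSeries.coeff s (blowup t) ≠ 0 ∧ s ≤ e := Nat.find_spec hex
  obtain ⟨τ, hτ⟩ : PowerSeries.X ^ s ∣ blowup t := PowerSeries.X_pow_dvd_iff.mpr fun m hm => by
    by_contra hne
    exact Nat.find_min hex hm ⟨hne, hm.le.trans hse⟩
  have hτ0 : PowerSeries.constantCoeff τ = PowerSeries.coeff s (blowup t) := by
    rw [hτ, ← PowerSeries.coeff_zero_eq_constantCoeff_apply]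
    simpa using (PowerSeries.coeff_X_pow_mul τ s 0).symm
  refine ⟨s, PowerSeries.constantCoeff τ, ?_, hse, hτ0 ▸ natDegree_coeff_blowup_le t s,
    fun i hi => ?_⟩
  · intro h0
    rw [h0, coeff_zero_blowup, mem_maximalIdeal_iff.mp ht, map_zero] at hs
    exact hs rfl
  · obtain ⟨a, b, hab⟩ := key i hi
    have h1 : blowup a * τ =
        PowerSeries.X ^ (e - s) *
          (PowerSeries.C (Polynomial.X ^ i) - blowup b * PowerSeries.C F) := by
      refine mul_left_cancel₀ (pow_ne_zero s PowerSeries.X_ne_zero) ?_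
      rw [← mul_assoc _ (PowerSeries.X ^ (e - s)), ← pow_add, Nat.add_sub_cancel' hse]
      rw [hτ] at hab
      linear_combination -hab
    obtain ⟨A, hA⟩ : PowerSeries.X ^ (e - s) ∣ blowup a := by
      refine PowerSeries.X_prime.pow_dvd_of_dvd_mul_right _ ?_ ⟨_, h1⟩
      rw [PowerSeries.X_dvd_iff, hτ0]
      exact hs
    have hA0 : PowerSeries.constantCoeff A = PowerSeries.coeff (e - s) (blowup a) := by
      rw [hA, ← PowerSeries.coeff_zero_eq_constantCoeff_apply]
      simpa using (PowerSeries.coeff_X_pow_mul A (e - s) 0).symm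
    have h2 : A * τ = PowerSeries.C (Polynomial.X ^ i) - blowup b * PowerSeries.C F := by
      refine mul_left_cancel₀ (pow_ne_zero (e - s) PowerSeries.X_ne_zero) ?_
      rw [← mul_assoc, ← hA, h1]
    refine ⟨PowerSeries.constantCoeff A, constantCoeff b, hA0 ▸ natDegree_coeff_blowup_le a _, ?_⟩
    have h3 := congrArg PowerSeries.constantCoeff h2
    rw [map_mul, map_sub, map_mul, PowerSeries.constantCoeff_C, PowerSeries.constantCoeff_C,
      ← PowerSeries.coeff_zero_eq_constantCoeff_apply (blowup b), coeff_zero_blowup] at h3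
    rw [h3, sub_add_cancel]

/-! ### A parameter for the upper bound -/

/-- Modulo `x + y ^ 2` the factor `x + α y` becomes `y (α - y)`, a unit times `y` if `α ≠ 0` and
`-y ^ 2` if `α = 0`, so that the product of all lines is a unit times `y ^ (|k| + 2)`. -/
theorem map_eq_zero_of_mem_pow {Q : Type*} [CommRing Q] (ψ : MvPowerSeries (Fin 2) k →+* Q)
    (hf : ψ (allLines k) = 0) (ht : ψ (X 0 + X 1 ^ 2) = 0) {p : MvPowerSeries (Fin 2) k}
    (hp : p ∈ IsLocalRing.maximalIdeal (MvPowerSeries (Fin 2) k) ^ (Fintype.card k + 2)) :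
    ψ p = 0 := by
  classical
  have hx : ψ (X 0) = -ψ (X 1) ^ 2 := by
    rw [map_add, map_pow] at ht
    linear_combination ht
  have hu : ∀ α : k, α ≠ 0 → IsUnit (ψ (C α - X 1)) := fun α hα => by
    refine IsUnit.map ψ (isUnit_iff_constantCoeff.mpr ?_)
    simpa using hα
  have hy : ψ (X 1) ^ (Fintype.card k + 2) = 0 := by
    have hfac (α : k) : ψ (X 0 + C α * X 1) = ψ (X 1) * ψ (C α - X 1) := by
      rw [map_add, map_mul, map_sub, hx]
      ring
    have hprod : IsUnit (∏ α ∈ Finset.univ.erase (0 : k), ψ (C α - X 1)) :=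
      IsUnit.prod_iff.mpr fun α hα => hu α (Finset.ne_of_mem_erase hα)
    rw [allLines, map_mul, map_prod, Finset.prod_congr rfl fun α _ => hfac α,
      Finset.prod_mul_distrib, Finset.prod_const, Finset.card_univ,
      ← Finset.mul_prod_erase _ _ (Finset.mem_univ (0 : k)), map_zero, zero_sub, map_neg] at hf
    rw [← hprod.mul_left_eq_zero]
    linear_combination -hf
  have hle : (IsLocalRing.maximalIdeal (MvPowerSeries (Fin 2) k)).map ψ ≤
      Ideal.span {ψ (X 1)} := by
    rw [maximalIdeal_eq_span, Ideal.map_span, Ideal.span_le, Set.image_pair]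
    rintro _ (rfl | rfl)
    · rw [hx, SetLike.mem_coe, Ideal.mem_span_singleton, dvd_neg]
      exact dvd_pow_self _ two_ne_zero
    · exact Ideal.mem_span_singleton_self _
  have := Ideal.pow_right_mono hle (Fintype.card k + 2)
    (Ideal.map_pow ψ _ _ ▸ Ideal.mem_map_of_mem ψ hp)
  rwa [Ideal.span_singleton_pow, hy, Ideal.span_singleton_zero, Ideal.mem_bot] at this

end AllLines

/-! ### Free summands and the delta invariant -/

theorem auslanderDelta_eq_zero {R M X : Type u} [CommRing R] [IsLocalRing R] [AddCommGroup M]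
    [Module R M] [AddCommGroup X] [Module R X] (hX : IsMaximalCohenMacaulay R X)
    (hfree : HasNoFreeSummand R X) (φ : X →ₗ[R] M) (hφ : Function.Surjective φ) :
    auslanderDelta R M = 0 :=
  Nat.sInf_eq_zero.mpr (Or.inl ⟨X, inferInstance, inferInstance, hX, hfree,
    φ ∘ₗ LinearMap.fst _ _ _, hφ.comp Prod.fst_surjective⟩)

theorem auslanderDelta_quotient_eq_one {R : Type u} [CommRing R] [IsLocalRing R] {J : Ideal R}
    (h : ∀ (X : Type u) [AddCommGroup X] [Module R X], IsMaximalCohenMacaulay R X →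
      HasNoFreeSummand R X → ∀ φ : X →ₗ[R] R ⧸ J, ¬ Function.Surjective φ) :
    auslanderDelta R (R ⧸ J) = 1 := by
  have hmem : 1 ∈ {n : ℕ | ∃ (X : Type u) (_ : AddCommGroup X) (_ : Module R X),
      IsMaximalCohenMacaulay R X ∧ HasNoFreeSummand R X ∧
        ∃ φ : (X × (Fin n → R)) →ₗ[R] R ⧸ J, Function.Surjective φ} :=
    ⟨PUnit, inferInstance, inferInstance, ⟨inferInstance, Or.inl inferInstance⟩,
      fun P Q _ _ => Subsingleton.elim _ _,
      Submodule.mkQ _ ∘ₗ LinearMap.proj 0 ∘ₗ LinearMap.snd _ _ _,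
      (Submodule.mkQ_surjective _).comp ((Function.surjective_eval 0).comp Prod.snd_surjective)⟩
  refine le_antisymm (Nat.sInf_le hmem) (Nat.one_le_iff_ne_zero.mpr fun h0 => ?_)
  rcases Nat.sInf_eq_zero.mp h0 with ⟨X, _, _, hX, hfree, φ, hφ⟩ | hempty
  · refine h X hX hfree (φ ∘ₗ LinearMap.inl _ _ _) fun u => ?_
    obtain ⟨⟨v, w⟩, rfl⟩ := hφ u
    exact ⟨v, congrArg φ (Prod.ext rfl (Subsingleton.elim _ _))⟩
  · exact Set.eq_empty_iff_forall_notMem.mp hempty 1 hmem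

theorem hasNoFreeSummand_of_smul_eq_zero {R X : Type u} [CommRing R] [IsLocalRing R]
    [AddCommGroup X] [Module R X] {a : R} (ha : a ≠ 0) (h : ∀ u : X, a • u = 0) :
    HasNoFreeSummand R X := by
  intro P Q _ hP
  by_contra hne
  have : Nontrivial P := Submodule.nontrivial_iff_ne_bot.mpr hne
  refine ha (FaithfulSMul.eq_of_smul_eq_smul (M := R) (α := P) fun p => ?_)
  rw [zero_smul]
  exact Subtype.ext (h p)

section AllLinesRing

open MvPowerSeries IsLocalRing

variable (k : Type u) [Field k] [Fintype k]

/-! ### The ring `k⟦x, y⟧ ⧸ (f)` and its dimension -/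

theorem allLinesRing_map_maximalIdeal_pow (n : ℕ) :
    (maximalIdeal (MvPowerSeries (Fin 2) k) ^ n).map
        (Ideal.Quotient.mk (Ideal.span {allLines k})) =
      maximalIdeal (AllLinesRing k) ^ n := by
  rw [Ideal.map_pow, map_maximalIdeal_of_surjective _ Ideal.Quotient.mk_surjective]

theorem allLinesRing_comap_maximalIdeal_pow :
    (maximalIdeal (AllLinesRing k) ^ (Fintype.card k + 1)).comap
        (Ideal.Quotient.mk (Ideal.span {allLines k})) =
      maximalIdeal (MvPowerSeries (Fin 2) k) ^ (Fintype.card k + 1) := by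
  rw [← allLinesRing_map_maximalIdeal_pow, Ideal.comap_map_mk]
  rw [Ideal.span_singleton_le_iff_mem]
  exact allLines_mem_pow

/-- The class of `x + y ^ 2`, a parameter of the ring of all lines. -/
noncomputable def allLinesParameter : AllLinesRing k :=
  Ideal.Quotient.mk _ (X 0 + X 1 ^ 2)

theorem allLinesParameter_mem : allLinesParameter k ∈ maximalIdeal (AllLinesRing k) := by
  rw [← map_maximalIdeal_of_surjective _
    (Ideal.Quotient.mk_surjective (I := Ideal.span {allLines k}))]
  exact Ideal.mem_map_of_mem _ (mem_maximalIdeal_iff.mpr (by simp))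

theorem maximalIdeal_pow_le_span_allLinesParameter :
    maximalIdeal (AllLinesRing k) ^ (Fintype.card k + 2) ≤ Ideal.span {allLinesParameter k} := by
  rw [← allLinesRing_map_maximalIdeal_pow, Ideal.map_le_iff_le_comap]
  intro p hp
  have := map_eq_zero_of_mem_pow (Q := AllLinesRing k ⧸ Ideal.span {allLinesParameter k})
    ((Ideal.Quotient.mk (Ideal.span {allLinesParameter k})).comp (Ideal.Quotient.mk _)) ?_ ?_ hp
  · exact Ideal.mem_comap.mpr (Ideal.Quotient.eq_zero_iff_mem.mp this)
  · rw [RingHom.comp_apply, Ideal.Quotient.mk_singleton_self, map_zero]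
  · exact Ideal.Quotient.mk_singleton_self _

theorem radical_span_allLinesParameter :
    (Ideal.span {allLinesParameter k}).radical = maximalIdeal (AllLinesRing k) := by
  apply le_antisymm
  · refine Ideal.IsPrime.radical_le_iff inferInstance |>.mpr ?_
    rw [Ideal.span_singleton_le_iff_mem]
    exact allLinesParameter_mem k
  · intro p hp
    exact ⟨_, maximalIdeal_pow_le_span_allLinesParameter k (Ideal.pow_mem_pow hp _)⟩

theorem ringKrullDim_allLinesRing : ringKrullDim (AllLinesRing k) = 1 := by
  rw [← maximalIdeal_height_eq_ringKrullDim]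
  have hle : (maximalIdeal (AllLinesRing k)).height ≤ 1 := by
    refine Ideal.height_le_one_of_isPrincipal_of_mem_minimalPrimes
      (Ideal.span {allLinesParameter k}) _ ⟨⟨inferInstance, ?_⟩, fun P hP _ => ?_⟩
    · rw [Ideal.span_singleton_le_iff_mem]
      exact allLinesParameter_mem k
    · rw [← radical_span_allLinesParameter]
      exact hP.1.radical_le_iff.mpr hP.2
  have hne : (maximalIdeal (AllLinesRing k)).height ≠ 0 := by
    rw [Ne, Ideal.height_eq_zero_iff]
    intro hmin
    -- The line `x = 0` is a prime ideal strictly below the maximal ideal.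
    have hx : (Ideal.span {(X 0 : MvPowerSeries (Fin 2) k)}).IsPrime :=
      (Ideal.span_singleton_prime prime_X_zero.ne_zero).mpr prime_X_zero
    have hfx : Ideal.span {allLines k} ≤ Ideal.span {(X 0 : MvPowerSeries (Fin 2) k)} := by
      rw [Ideal.span_singleton_le_span_singleton]
      refine Dvd.dvd.mul_left ?_ _
      have := Finset.dvd_prod_of_mem
        (fun α : k => (X 0 + C α * X 1 : MvPowerSeries (Fin 2) k)) (Finset.mem_univ 0)
      rwa [map_zero, zero_mul, add_zero] at this
    have hP : ((Ideal.span {(X 0 : MvPowerSeries (Fin 2) k)}).map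
        (Ideal.Quotient.mk (Ideal.span {allLines k}))).IsPrime :=
      Ideal.map_isPrime_of_surjective Ideal.Quotient.mk_surjective (by rwa [Ideal.mk_ker])
    have hle := hmin.2 ⟨hP, bot_le⟩ (le_maximalIdeal hP.ne_top)
    rw [← map_maximalIdeal_of_surjective _
      (Ideal.Quotient.mk_surjective (I := Ideal.span {allLines k})),
      Ideal.map_le_iff_le_comap, Ideal.comap_map_mk hfx] at hle
    exact not_X_zero_dvd_X_one (Ideal.mem_span_singleton.mp (hle X_one_mem_maximalIdeal))
  have : (maximalIdeal (AllLinesRing k)).height = 1 :=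
    le_antisymm hle (Order.one_le_iff_ne_zero.mpr hne)
  rw [this]
  rfl

/-! ### The generalized Loewy length -/

theorem generalizedLoewyLength_allLinesRing :
    generalizedLoewyLength (AllLinesRing k) = (Fintype.card k : ℕ∞) + 2 := by
  apply le_antisymm
  · refine sInf_le ⟨Fintype.card k + 2, by push_cast; rfl, by omega, 1,
      fun _ => allLinesParameter k, ⟨?_, fun _ => allLinesParameter_mem k, ?_⟩, ?_⟩
    · rw [ringKrullDim_allLinesRing]; rfl
    · rw [Set.range_const]; exact radical_span_allLinesParameter k
    · rw [Set.range_const]; exact maximalIdeal_pow_le_span_allLinesParameter k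
  · refine le_sInf ?_
    rintro _ ⟨n, rfl, -, d, x, ⟨hd, hx, -⟩, hn⟩
    rw [ringKrullDim_allLinesRing] at hd
    obtain rfl : d = 1 := by exact_mod_cast hd
    by_contra hlt
    have hlt : n ≤ Fintype.card k + 1 := by
      have : ((n : ℕ) : ℕ∞) < ((Fintype.card k + 2 : ℕ) : ℕ∞) := by
        push_cast; exact not_le.mp hlt
      have := Nat.cast_lt.mp this
      omega
    rw [Set.range_unique] at hn
    obtain ⟨t, ht⟩ := Ideal.Quotient.mk_surjective (x default)
    have htm : t ∈ maximalIdeal (MvPowerSeries (Fin 2) k) := by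
      have h := hx default
      rw [← ht, ← Ideal.mem_comap] at h
      exact le_maximalIdeal (Ideal.comap_ne_top _ (Ideal.IsPrime.ne_top inferInstance)) h
    obtain ⟨s, τ, hs, hsq, hτ, h⟩ := exists_forall_X_pow_eq htm fun p hp => by
      have hp' : Ideal.Quotient.mk (Ideal.span {allLines k}) p ∈ Ideal.span {x default} :=
        (Ideal.pow_le_pow_right hlt).trans hn
          (allLinesRing_map_maximalIdeal_pow k _ ▸ Ideal.mem_map_of_mem _ hp)
      obtain ⟨a, ha⟩ := Ideal.mem_span_singleton'.mp hp'
      obtain ⟨a, rfl⟩ := Ideal.Quotient.mk_surjective a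
      rw [← ht, ← map_mul, eq_comm, Ideal.Quotient.eq, Ideal.mem_span_singleton'] at ha
      obtain ⟨b, hb⟩ := ha
      exact ⟨a, b, by rw [hb]; ring⟩
    exact false_of_forall_X_pow_eq natDegree_prod_X_add_C.le eval_prod_X_add_C hs hsq hτ h

/-! ### The index -/

/-- The module `X = R ⧸ (f / x)`, on which `x` is regular, maps onto `R ⧸ 𝔪 ^ n`. -/
theorem auslanderDelta_allLinesRing_of_le {n : ℕ} (hn : n ≤ Fintype.card k) :
    auslanderDelta (AllLinesRing k) (AllLinesRing k ⧸ maximalIdeal (AllLinesRing k) ^ n) = 0 := by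
  classical
  let g : MvPowerSeries (Fin 2) k := X 1 * ∏ α ∈ Finset.univ.erase (0 : k), (X 0 + C α * X 1)
  have hfg : allLines k = X 0 * g := by
    rw [allLines, ← Finset.mul_prod_erase _ _ (Finset.mem_univ (0 : k)), map_zero, zero_mul,
      add_zero]
    ring
  have hgn : g ∈ maximalIdeal (MvPowerSeries (Fin 2) k) ^ n := by
    refine Ideal.pow_le_pow_right hn ?_
    have := X_one_mul_prod_mem_pow (Finset.univ.erase (0 : k))
    rwa [Finset.card_erase_of_mem (Finset.mem_univ _), Finset.card_univ,
      Nat.sub_add_cancel Fintype.card_pos] at this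
  have hxg : ¬ X 0 ∣ g := by
    intro h
    rcases prime_X_zero.dvd_or_dvd h with h | h
    · exact not_X_zero_dvd_X_one h
    · obtain ⟨α, hα, h⟩ := (prime_X_zero.dvd_finsetProd_iff _).mp h
      exact not_X_zero_dvd_C_mul_X_one (Finset.ne_of_mem_erase hα)
        ((dvd_add_right dvd_rfl).mp h)
  let gbar : AllLinesRing k := Ideal.Quotient.mk _ g
  let xbar : AllLinesRing k := Ideal.Quotient.mk _ (X 0)
  have hgbar : gbar ≠ 0 := by
    intro h
    obtain ⟨c, hc⟩ := Ideal.mem_span_singleton.mp (Ideal.Quotient.eq_zero_iff_mem.mp h)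
    exact hxg ⟨g * c, by rw [← mul_assoc, ← hfg]; exact hc⟩
  have hgbarn : gbar ∈ maximalIdeal (AllLinesRing k) ^ n :=
    allLinesRing_map_maximalIdeal_pow k n ▸ Ideal.mem_map_of_mem _ hgn
  have hxbar : xbar ∈ maximalIdeal (AllLinesRing k) := by
    rw [← pow_one (maximalIdeal _), ← allLinesRing_map_maximalIdeal_pow, pow_one]
    exact Ideal.mem_map_of_mem _ (mem_maximalIdeal_iff.mpr (constantCoeff_X _))
  have hreg : IsSMulRegular (AllLinesRing k ⧸ Ideal.span {gbar}) xbar := by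
    rw [isSMulRegular_iff_right_eq_zero_of_smul]
    intro u hu
    obtain ⟨u, rfl⟩ := Ideal.Quotient.mk_surjective u
    obtain ⟨u, rfl⟩ := Ideal.Quotient.mk_surjective u
    have hu : xbar * Ideal.Quotient.mk _ u ∈ Ideal.span {gbar} :=
      Ideal.Quotient.eq_zero_iff_mem.mp hu
    obtain ⟨v, hv⟩ := Ideal.mem_span_singleton'.mp hu
    obtain ⟨v, rfl⟩ := Ideal.Quotient.mk_surjective v
    rw [← map_mul, ← map_mul, Ideal.Quotient.eq, Ideal.mem_span_singleton, hfg] at hv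
    obtain ⟨c, hc⟩ := hv
    obtain ⟨w, hw⟩ : X 0 ∣ v := by
      refine (prime_X_zero.dvd_or_dvd (b := g) ⟨u + g * c, ?_⟩).resolve_right hxg
      linear_combination hc
    have huw : u = w * g - c * g := by
      refine mul_left_cancel₀ (prime_X_zero (k := k)).ne_zero ?_
      rw [hw] at hc
      linear_combination -hc
    rw [Ideal.Quotient.eq_zero_iff_mem, huw, Ideal.mem_span_singleton', ← sub_mul]
    exact ⟨Ideal.Quotient.mk _ (w - c), (map_mul _ _ _).symm⟩
  have hgn' : gbar ∈ maximalIdeal (AllLinesRing k) := by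
    rw [← map_maximalIdeal_of_surjective _
      (Ideal.Quotient.mk_surjective (I := Ideal.span {allLines k}))]
    exact Ideal.mem_map_of_mem _ (Ideal.mul_mem_right _ _ X_one_mem_maximalIdeal)
  have : Nontrivial (AllLinesRing k ⧸ Ideal.span {gbar}) :=
    Ideal.Quotient.nontrivial_iff.mpr fun h =>
      (Ideal.IsPrime.ne_top inferInstance : maximalIdeal (AllLinesRing k) ≠ ⊤)
        (top_le_iff.mp (h ▸ (Ideal.span_singleton_le_iff_mem _).mpr hgn'))
  refine auslanderDelta_eq_zero (X := AllLinesRing k ⧸ Ideal.span {gbar})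
    ⟨inferInstance, Or.inr ⟨[xbar], by simpa using hxbar, ?_, ?_⟩⟩ ?_
    (Submodule.factor ((Ideal.span_singleton_le_iff_mem _).mpr hgbarn))
    (Submodule.factor_surjective _)
  · rw [ringKrullDim_allLinesRing]; rfl
  · exact (isRegular_iff_isWeaklyRegular_of_subset_maximalIdeal (by simpa using hxbar)).mpr
      ((RingTheory.Sequence.isWeaklyRegular_singleton_iff _ _).mpr hreg)
  · refine hasNoFreeSummand_of_smul_eq_zero hgbar fun u => ?_
    obtain ⟨u, rfl⟩ := Ideal.Quotient.mk_surjective u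
    exact Ideal.Quotient.eq_zero_iff_mem.mpr
      (Ideal.mul_mem_right _ _ (Ideal.mem_span_singleton_self _))

theorem auslanderDelta_allLinesRing_card_add_one :
    auslanderDelta (AllLinesRing k)
      (AllLinesRing k ⧸ maximalIdeal (AllLinesRing k) ^ (Fintype.card k + 1)) = 1 := by
  have hJ : maximalIdeal (AllLinesRing k) ^ (Fintype.card k + 1) ≠ ⊤ := fun h =>
    (Ideal.IsPrime.ne_top inferInstance : maximalIdeal (AllLinesRing k) ≠ ⊤)
      (top_le_iff.mp (h ▸ Ideal.pow_le_self (Nat.succ_ne_zero _)))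
  refine auslanderDelta_quotient_eq_one fun X _ _ ⟨hfin, hX⟩ hfree φ hφ => ?_
  obtain ⟨r, hr, hreg⟩ : ∃ r ∈ maximalIdeal (AllLinesRing k), IsSMulRegular X r := by
    rcases hX with hX | ⟨rs, hrs, hlen, hreg⟩
    · exact ⟨0, zero_mem _, fun _ _ _ => Subsingleton.elim _ _⟩
    · rw [ringKrullDim_allLinesRing] at hlen
      obtain ⟨r, rfl⟩ := List.length_eq_one_iff.mp (by exact_mod_cast hlen)
      exact ⟨r, hrs r (by simp),
        (RingTheory.Sequence.isWeaklyRegular_singleton_iff _ _).mp hreg.toIsWeaklyRegular⟩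
  have := mem_maximalIdeal_mul_comap_of_surjective prime_X_zero not_X_zero_dvd_X_one
    maximalIdeal_eq_span hfree hr hreg hJ φ hφ
  rw [allLinesRing_comap_maximalIdeal_pow, ← pow_succ'] at this
  exact allLines_notMem_pow this

theorem localIndex_allLinesRing :
    localIndex (AllLinesRing k) = (Fintype.card k : ℕ∞) + 1 := by
  apply le_antisymm
  · exact sInf_le ⟨Fintype.card k + 1, by push_cast; rfl, by omega,
      auslanderDelta_allLinesRing_card_add_one k⟩
  · refine le_sInf ?_
    rintro _ ⟨n, rfl, -, hn⟩
    by_contra hlt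
    have hlt : n ≤ Fintype.card k := by
      have : ((n : ℕ) : ℕ∞) < ((Fintype.card k + 1 : ℕ) : ℕ∞) := by
        push_cast; exact not_le.mp hlt
      have := Nat.cast_lt.mp this
      omega
    rw [auslanderDelta_allLinesRing_of_le k hlt] at hn
    exact zero_ne_one hn

end AllLinesRing

theorem proposition3p5 (k : Type u) [Field k] [Fintype k] :
    generalizedLoewyLength (AllLinesRing k) = localIndex (AllLinesRing k) + 1 ∧
      localIndex (AllLinesRing k) + 1 = (Fintype.card k : ℕ∞) + 2 := by
  rw [generalizedLoewyLength_allLinesRing, localIndex_allLinesRing, add_assoc, one_add_one_eq_two]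
  exact ⟨rfl, rfl⟩
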